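/- Let $PW_\pi$ be the space of functions $f\in L^2(\mathbb R)$ whose Fourier transform $\widehat f(\xi)=\int_{\mathbb R}f(x)e^{-2\pi i x\xi}\,dx$ (in the $L^2$ sense) vanishes almost everywhere outside $[-\tfrac12,\tfrac12]$; each such $f$ is identified with its entire representative, so that $f(z)$ makes sense for every $z\in\mathbb C$. Let $\mathrm{sinc}(z)=\frac{\sin(\pi z)}{\pi z}$ for $z\neq0$ and $\mathrm{sinc}(0)=1$. Let $N\ge 1$ be an integer and $a_1,\dots,a_N\in\mathbb C$. Say that functions $g_1,\dots,g_N\in PW_\pi$ give an interpolation formula depending on $\{f(Nm+a_n)\}$ if for every $f\in PW_\pi$ $$f(x)=\sum_{n=1}^N\sum_{m\in\mathbb Z}f(Nm+a_n)\,g_n(x-Nm),\qquad x\in\mathbb R,$$ where the double series converges unconditionally both in $L^2(\mathbb R)$ and uniformly on $\mathbb R$. (1) If $a_n-a_m\notin N\mathbb Z$ for all $n\neq m$, then the functions $$g_n(x)=\mathrm{sinc}\Big(\frac{x-a_n}{N}\Big)\prod_{\substack{s=1\\ s\neq n}}^N\frac{\sin(\pi(x-a_s)/N)}{\sin(\pi(a_n-a_s)/N)}$$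 belong to $PW_\pi$ and give an interpolation formula; that is, for every $f\in PW_\pi$ and $x\in\mathbb R$, $$f(x)=\sum_{n=1}^N\sum_{m\in\mathbb Z}f(Nm+a_n)\,\mathrm{sinc}\Big(\frac{x-Nm-a_n}{N}\Big)\prod_{\substack{s=1\\ s\neq n}}^N\frac{\sin(\pi(x-Nm-a_s)/N)}{\sin(\pi(a_n-a_s)/N)},$$ with unconditional convergence both in $L^2(\mathbb R)$ and uniformly on $\mathbb R$. (2) Functions $g_1,\dots,g_N\in PW_\pi$ giving an interpolation formula depending on $\{f(Nm+a_n)\}$ exist if and only if $a_n-a_m\notin N\mathbb Z$ for all $n\neq m$. (3) If $a_n-a_m\in N\mathbb Z$ for some $n\ne m$, then the values $\{f(Nm+a_n)\}$ do not determine $f$: there is an $f\in PW_\pi$, not identically zero on $\mathbb R$, with $f(Nm+a_n)=0$ for all $n=1,\dots,N$ and all $m\in\mathbb Z$. Hence no formula of any kind recovers every $f\in PW_\pi$ from these values. -/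

import Mathlib

open MeasureTheory Filter Topology
open scoped FourierTransform

/-- The Paley-Wiener space of type `2πδ`. An element is given by its entire representative
`f : ℂ → ℂ`: the restriction of `f` to the real line is square integrable and the `L²` Fourier
transform of that restriction (normalised with the kernel `exp (-2πixξ)`) vanishes almost
everywhere outside `[-δ, δ]`. -/
def PaleyWiener (δ : ℝ) : Set (ℂ → ℂ) :=
  {f | Differentiable ℂ f ∧
    ∃ hf : MemLp (fun x : ℝ => f (x : ℂ)) 2 (volume : Measure ℝ),
      ∀ᵐ ξ : ℝ ∂volume, ξ ∉ Set.Icc (-δ) δ →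
        (𝓕 (hf.toLp (fun x : ℝ => f (x : ℂ))) : Lp ℂ 2 (volume : Measure ℝ)) ξ = 0}

/-- The cardinal sine `sin (π z) / (π z)`, with its removable singularity at `0` filled in. -/
noncomputable def cardinalSine (z : ℂ) : ℂ :=
  if z = 0 then 1 else Complex.sin (Real.pi * z) / (Real.pi * z)

/-- The finite partial sum over `S` of the double series
`∑ n, ∑ m ∈ ℤ, f (N m + a n) * g n (x - N m)`. -/
noncomputable def samplingPartialSum (N : ℕ) (a : Fin N → ℂ) (g : Fin N → ℂ → ℂ) (f : ℂ → ℂ)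
    (S : Finset (Fin N × ℤ)) (x : ℝ) : ℂ :=
  ∑ p ∈ S, f ((N : ℂ) * (p.2 : ℂ) + a p.1) * g p.1 ((x : ℂ) - (N : ℂ) * (p.2 : ℂ))

/-- The functions `g n` belong to `PW_π` and reconstruct every `f` in `PW_π` by
`f x = ∑ n, ∑ m ∈ ℤ, f (N m + a n) * g n (x - N m)`, with (unconditional) convergence of the
series both in `L²(ℝ)` and uniformly on `ℝ`. -/
def IsInterpolationFormula (N : ℕ) (a : Fin N → ℂ) (g : Fin N → ℂ → ℂ) : Prop :=
  (∀ n, g n ∈ PaleyWiener (1 / 2)) ∧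
  ∀ f ∈ PaleyWiener (1 / 2),
    Tendsto (fun S : Finset (Fin N × ℤ) =>
      eLpNorm (fun x : ℝ => f (x : ℂ) - samplingPartialSum N a g f S x) 2 volume) atTop (𝓝 0) ∧
    TendstoUniformly (samplingPartialSum N a g f) (fun x : ℝ => f (x : ℂ)) atTop

/-! Write f(z) = ∫ φ(ξ) e^{2πizξ} dξ with φ in L² supported on (-1/2, 1/2], and cut this band into N
bands of width 1/N. Moving each piece to the origin gives, with w(z) = e^{2πiz/N}, f(z) =
e^{-πi(N-1)z/N} ∑_{k<N} w(z)^k f_k(z), where every f_k has spectrum in (-1/(2N), 1/(2N)]. On N ℤ + u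
the function w is constant, so there f is, up to the modulation, the function F_u = ∑ w(u)^k f_k,
whose spectrum lies in the same narrow band. The classical sampling theorem at spacing N recovers
F_u (`tendsto_eLpNorm_samplingRemainder`).

To return to f, use Lagrange interpolation at the nodes w(a_n), which are distinct exactly when the
a_n are distinct modulo N ℤ: y^k = ∑ w(a_n)^k L_n(y) for k < N, so f(z) = e^{-πi(N-1)z/N} ∑
L_n(w(z)) F_{a_n}(z) (`bandSynthesis_eq_sum_lagrangeBasis`). The sine products in the formula are
these L_n(w(z)) up to modulation (`prod_sin_div_sin`). The error is thus a finite sum of bounded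
multiples of classical sampling errors; Plancherel and Cauchy–Schwarz make it small in L² and
uniformly.

If a_n and a_m agree modulo N ℤ, the kernel attached to n, without its normalising denominators,
vanishes at every sample. -/

/-! ### Densities supported on an interval and their Fourier–Laplace transforms. -/

/-- The `L²` inverse Fourier transform of an integrable function is given by the integral. -/
theorem fourierInv_toLp_ae_eq {φ : ℝ → ℂ} (h2 : MemLp φ 2 volume) (h1 : Integrable φ) :
    ((𝓕⁻ (h2.toLp φ) : Lp ℂ 2 (volume : Measure ℝ)) : ℝ → ℂ) =ᵐ[volume] 𝓕⁻ φ := by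
  have hcont : Continuous (𝓕⁻ φ) := by
    rw [Real.fourierInv_eq_fourier_comp_neg]
    exact (VectorFourier.fourierIntegral_continuous Real.continuous_fourierChar
      (by fun_prop) h1.comp_neg)
  apply ae_eq_of_integral_contDiff_smul_eq
  · exact (Lp.memLp _).locallyIntegrable (by norm_num)
  · exact hcont.locallyIntegrable
  · intro g g_smooth g_cpt
    have hg₁ : HasCompactSupport (Complex.ofRealCLM ∘ g) := g_cpt.comp_left rfl
    have hg₂ : ContDiff ℝ ((⊤ : ℕ∞) : WithTop ℕ∞) (Complex.ofRealCLM ∘ g) :=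
      Complex.ofRealCLM.contDiff.comp g_smooth
    set G : SchwartzMap ℝ ℂ := hg₁.toSchwartzMap hg₂ with hG
    -- Both sides are tested against G: the L² inverse through tempered distributions, the integral
    -- through Fubini.
    have e1 : ∫ x, G x • (𝓕⁻ (h2.toLp φ) : Lp ℂ 2 (volume : Measure ℝ)) x
        = ∫ x, (𝓕⁻ G) x • φ x := by
      rw [← Lp.toTemperedDistribution_apply, ← Lp.fourierInv_toTemperedDistribution_eq,
        TemperedDistribution.fourierInv_apply, Lp.toTemperedDistribution_apply]
      apply integral_congr_ae
      filter_upwards [h2.coeFn_toLp] with x hx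
      rw [hx]
    have e2 : ∫ x, (𝓕⁻ G) x • φ x = ∫ x, G x • (𝓕⁻ φ) x := by
      have := VectorFourier.integral_fourierIntegral_smul_eq_flip (L := -innerₗ ℝ)
        (μ := volume) (ν := volume) Real.continuous_fourierChar
        (by simp only [LinearMap.neg_apply]; fun_prop) G.integrable h1
      have hflip : (-innerₗ ℝ : ℝ →ₗ[ℝ] ℝ →ₗ[ℝ] ℝ).flip = -innerₗ ℝ := by
        ext; simp
      rw [hflip] at this
      rw [SchwartzMap.fourierInv_coe]
      exact this
    have e3 := e1.trans e2
    simpa [hG] using e3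

/-- The function with frequency density `φ`. -/
noncomputable def bandSynthesis (φ : ℝ → ℂ) (z : ℂ) : ℂ :=
  ∫ ξ : ℝ, φ ξ * Complex.exp (2 * Real.pi * Complex.I * z * ξ)

/-- `φ` is square integrable and vanishes outside `(s, t]`. -/
structure IsBandDensity (s t : ℝ) (φ : ℝ → ℂ) : Prop where
  memLp : MemLp φ 2 volume
  eq_zero : ∀ ξ, ξ ∉ Set.Ioc s t → φ ξ = 0

/-- `f` is the Fourier-Laplace transform of a square integrable density on `(s, t]`. -/
def BandLimited (s t : ℝ) (f : ℂ → ℂ) : Prop :=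
  ∃ φ, IsBandDensity s t φ ∧ f = bandSynthesis φ

namespace IsBandDensity

variable {s t : ℝ} {φ : ℝ → ℂ}

/-- Only boundedness of the factor on [s, t] matters; the exponentials with nonreal z are unbounded
on ℝ. -/
theorem memLp_mul (h : IsBandDensity s t φ) {e : ℝ → ℂ} (he : Continuous e) {p : ENNReal}
    (hφ : MemLp φ p volume) : MemLp (fun ξ => φ ξ * e ξ) p volume := by
  obtain ⟨C, hC⟩ := (isCompact_Icc (a := s) (b := t)).exists_bound_of_continuousOn
    he.continuousOn
  refine hφ.of_le_mul (c := C) (hφ.1.mul he.aestronglyMeasurable) (.of_forall fun ξ => ?_)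
  by_cases hξ : ξ ∈ Set.Ioc s t
  · rw [norm_mul, mul_comm]
    exact mul_le_mul_of_nonneg_right (hC ξ (Set.Ioc_subset_Icc_self hξ)) (norm_nonneg _)
  · simp [h.eq_zero ξ hξ]

theorem mul_continuous (h : IsBandDensity s t φ) {e : ℝ → ℂ} (he : Continuous e) :
    IsBandDensity s t (fun ξ => φ ξ * e ξ) :=
  ⟨h.memLp_mul he h.memLp, fun ξ hξ => by simp [h.eq_zero ξ hξ]⟩

theorem support_subset (h : IsBandDensity s t φ) : Function.support φ ⊆ Set.Ioc s t :=
  fun ξ hξ => by_contra fun hn => hξ (h.eq_zero ξ hn)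

theorem eLpNorm_one_le (h : IsBandDensity s t φ) :
    eLpNorm φ 1 volume ≤ eLpNorm φ 2 volume * ENNReal.ofReal (t - s) ^ (1 / 2 : ℝ) := by
  have key := eLpNorm_le_eLpNorm_mul_rpow_measure_univ (p := 1) (q := 2)
    (μ := volume.restrict (Set.Ioc s t)) (by norm_num) h.memLp.1.restrict
  rw [eLpNorm_restrict_eq_of_support_subset h.support_subset,
    eLpNorm_restrict_eq_of_support_subset h.support_subset] at key
  convert key using 3
  · simp
  · norm_num

theorem integrable (h : IsBandDensity s t φ) : Integrable φ := by
  rw [← memLp_one_iff_integrable]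
  refine ⟨h.memLp.1, h.eLpNorm_one_le.trans_lt ?_⟩
  exact ENNReal.mul_lt_top h.memLp.2 (by finiteness)

theorem integrable_mul (h : IsBandDensity s t φ) {e : ℝ → ℂ} (he : Continuous e) :
    Integrable (fun ξ => φ ξ * e ξ) :=
  (h.mul_continuous he).integrable

theorem differentiable (h : IsBandDensity s t φ) : Differentiable ℂ (bandSynthesis φ) := by
  intro z₀
  set R := max |s| |t|
  have hR : ∀ ξ ∈ Set.Ioc s t, |ξ| ≤ R := fun ξ hξ => abs_le_max_abs_abs hξ.1.le hξ.2
  have key := hasDerivAt_integral_of_dominated_loc_of_deriv_le (μ := volume)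
    (F := fun (z : ℂ) (ξ : ℝ) => φ ξ * Complex.exp (2 * Real.pi * Complex.I * z * ξ))
    (F' := fun (z : ℂ) (ξ : ℝ) => φ ξ * (Complex.exp (2 * Real.pi * Complex.I * z * ξ) *
      (2 * Real.pi * Complex.I * ξ)))
    (bound := fun ξ => ‖φ ξ‖ * (Real.exp (2 * Real.pi * (‖z₀‖ + 1) * R) * (2 * Real.pi * R)))
    (x₀ := z₀) (s := Metric.ball z₀ 1) (Metric.ball_mem_nhds z₀ one_pos)
    (.of_forall fun z => (h.integrable_mul (by fun_prop)).1) (h.integrable_mul (by fun_prop))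
    (h.integrable_mul (by fun_prop)).1 ?_ (h.integrable.norm.mul_const _) ?_
  · exact key.2.differentiableAt
  · refine .of_forall fun ξ z hz => ?_
    by_cases hξ : ξ ∈ Set.Ioc s t
    · rw [norm_mul]
      refine mul_le_mul_of_nonneg_left ?_ (norm_nonneg _)
      have hz' : ‖z‖ ≤ ‖z₀‖ + 1 := by
        have h1 := norm_le_norm_add_norm_sub' z z₀
        rw [mem_ball_iff_norm] at hz
        linarith
      have h2 : ‖(2 * Real.pi * Complex.I * ξ : ℂ)‖ = 2 * Real.pi * |ξ| := by
        simp [abs_of_pos Real.pi_pos]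
      have hR0 : 0 ≤ R := (abs_nonneg _).trans (hR ξ hξ)
      rw [norm_mul, h2]
      refine mul_le_mul ((Complex.norm_exp_le_exp_norm _).trans (Real.exp_le_exp.2 ?_)) ?_
        (by positivity) (by positivity)
      · rw [mul_right_comm, norm_mul, h2]
        have := mul_le_mul (hR ξ hξ) hz' (norm_nonneg _) hR0
        nlinarith [Real.pi_pos]
      · have := hR ξ hξ
        have := Real.pi_pos
        gcongr
    · simp [h.eq_zero ξ hξ]
  · refine .of_forall fun ξ z _ => ?_
    refine HasDerivAt.const_mul _ (HasDerivAt.cexp ?_)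
    simpa using ((hasDerivAt_id z).const_mul (2 * Real.pi * Complex.I : ℂ)).mul_const (ξ : ℂ)

/-- Cauchy–Schwarz on the bounded band. This turns L² convergence of densities into uniform
convergence on ℝ. -/
theorem enorm_bandSynthesis_le (h : IsBandDensity s t φ) (x : ℝ) :
    ‖bandSynthesis φ x‖ₑ ≤ eLpNorm φ 2 volume * ENNReal.ofReal (t - s) ^ (1 / 2 : ℝ) := by
  refine le_trans ?_ h.eLpNorm_one_le
  rw [eLpNorm_one_eq_lintegral_enorm]
  refine (enorm_integral_le_lintegral_enorm _).trans (lintegral_mono fun ξ => ?_)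
  rw [enorm_mul, ← ofReal_norm (Complex.exp _), Complex.norm_exp]
  simp

theorem fourierInv_eq (φ : ℝ → ℂ) (x : ℝ) : 𝓕⁻ φ x = bandSynthesis φ x := by
  rw [Real.fourierInv_eq', bandSynthesis]
  congr with ξ
  rw [smul_eq_mul, mul_comm]
  congr 2
  simp only [RCLike.inner_apply, conj_trivial]
  push_cast
  ring

theorem bandSynthesis_ae_eq (h : IsBandDensity s t φ) :
    (fun x : ℝ => bandSynthesis φ x) =ᵐ[volume]
      (𝓕⁻ (h.memLp.toLp φ) : Lp ℂ 2 (volume : Measure ℝ)) := by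
  filter_upwards [fourierInv_toLp_ae_eq h.memLp h.integrable] with x hx
  rw [hx, fourierInv_eq]

theorem memLp_bandSynthesis (h : IsBandDensity s t φ) :
    MemLp (fun x : ℝ => bandSynthesis φ x) 2 volume :=
  (memLp_congr_ae h.bandSynthesis_ae_eq).2 (Lp.memLp _)

theorem eLpNorm_bandSynthesis (h : IsBandDensity s t φ) :
    eLpNorm (fun x : ℝ => bandSynthesis φ x) 2 volume = eLpNorm φ 2 volume := by
  rw [eLpNorm_congr_ae h.bandSynthesis_ae_eq]
  have h1 := Lp.norm_fourier_eq (𝓕⁻ (h.memLp.toLp φ) : Lp ℂ 2 (volume : Measure ℝ))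
  rw [FourierInvPair.fourier_fourierInv_eq, Lp.norm_def, Lp.norm_def,
    ENNReal.toReal_eq_toReal_iff' (Lp.eLpNorm_ne_top _) (Lp.eLpNorm_ne_top _)] at h1
  rw [← h1, eLpNorm_congr_ae h.memLp.coeFn_toLp]

end IsBandDensity

/-! ### The Paley–Wiener space as a space of transforms of densities. -/

theorem BandLimited.mem_paleyWiener {δ : ℝ} {f : ℂ → ℂ} (hf : BandLimited (-δ) δ f) :
    f ∈ PaleyWiener δ := by
  obtain ⟨φ, h, rfl⟩ := hf
  refine ⟨h.differentiable, h.memLp_bandSynthesis, ?_⟩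
  have e : h.memLp_bandSynthesis.toLp (fun x : ℝ => bandSynthesis φ x)
      = 𝓕⁻ (h.memLp.toLp φ) := by
    rw [← Lp.toLp_coeFn (𝓕⁻ (h.memLp.toLp φ)) (Lp.memLp _)]
    exact (MemLp.toLp_eq_toLp_iff _ _).2 h.bandSynthesis_ae_eq
  rw [e, FourierInvPair.fourier_fourierInv_eq]
  filter_upwards [h.memLp.coeFn_toLp] with ξ hξ hn
  rw [hξ]
  exact h.eq_zero ξ fun hm => hn (Set.Ioc_subset_Icc_self hm)

/-- Fourier inversion gives equality almost everywhere on ℝ, continuity gives it on all of ℝ, and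
the identity theorem extends it to ℂ. -/
theorem bandLimited_of_mem_paleyWiener {δ : ℝ} {f : ℂ → ℂ} (hf : f ∈ PaleyWiener δ) :
    BandLimited (-δ) δ f := by
  obtain ⟨hd, h2, hz⟩ := hf
  set u : Lp ℂ 2 (volume : Measure ℝ) := 𝓕 (h2.toLp fun x : ℝ => f x) with hu
  -- Dropping the endpoint -δ costs a null set, and half-open bands tile exactly.
  set φ : ℝ → ℂ := (Set.Ioc (-δ) δ).indicator u with hφ
  have hφu : φ =ᵐ[volume] u := by
    filter_upwards [hz, Ioc_ae_eq_Icc (μ := volume) (a := -δ) (b := δ)] with ξ h1 h3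
    rw [eq_iff_iff] at h3
    by_cases hξ : ξ ∈ Set.Ioc (-δ) δ
    · rw [hφ, Set.indicator_of_mem hξ]
    · rw [hφ, Set.indicator_of_notMem hξ, h1 fun hm => hξ (h3.2 hm)]
  have hb : IsBandDensity (-δ) δ φ :=
    ⟨(memLp_congr_ae hφu).2 (Lp.memLp u), fun ξ hξ => Set.indicator_of_notMem hξ _⟩
  refine ⟨φ, hb, ?_⟩
  have e : hb.memLp.toLp φ = u := by
    rw [← Lp.toLp_coeFn u (Lp.memLp u)]
    exact (MemLp.toLp_eq_toLp_iff _ _).2 hφu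
  have hae : (fun x : ℝ => f x) =ᵐ[volume] fun x : ℝ => bandSynthesis φ x := by
    have h3 := hb.bandSynthesis_ae_eq
    rw [e, hu, FourierPair.fourierInv_fourier_eq] at h3
    exact (h3.trans h2.coeFn_toLp).symm
  have heq := (Continuous.ae_eq_iff_eq volume (hd.continuous.comp Complex.continuous_ofReal)
    (hb.differentiable.continuous.comp Complex.continuous_ofReal)).1 hae
  refine AnalyticOnNhd.eq_of_frequently_eq (z₀ := 0)
    (Complex.analyticOnNhd_univ_iff_differentiable.2 hd)
    (Complex.analyticOnNhd_univ_iff_differentiable.2 hb.differentiable) ?_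
  have ht : Tendsto (fun x : ℝ => (x : ℂ)) (𝓝[≠] 0) (𝓝[≠] 0) := by
    refine tendsto_nhdsWithin_iff.2 ⟨?_, ?_⟩
    · exact (Complex.continuous_ofReal.tendsto' 0 0 (by simp)).mono_left nhdsWithin_le_nhds
    · filter_upwards [self_mem_nhdsWithin] with x hx
      simpa using hx
  exact ht.frequently (Eventually.frequently (.of_forall fun x => congrFun heq x))

theorem mem_paleyWiener_iff_bandLimited {δ : ℝ} {f : ℂ → ℂ} :
    f ∈ PaleyWiener δ ↔ BandLimited (-δ) δ f :=
  ⟨bandLimited_of_mem_paleyWiener, BandLimited.mem_paleyWiener⟩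

/-! ### Linear combinations, modulations and sine factors. -/

theorem IsBandDensity.add {s t : ℝ} {φ ψ : ℝ → ℂ} (hφ : IsBandDensity s t φ)
    (hψ : IsBandDensity s t ψ) : IsBandDensity s t (φ + ψ) :=
  ⟨hφ.memLp.add hψ.memLp, fun ξ hξ => by simp [hφ.eq_zero ξ hξ, hψ.eq_zero ξ hξ]⟩

theorem IsBandDensity.const_smul {s t : ℝ} {φ : ℝ → ℂ} (hφ : IsBandDensity s t φ) (c : ℂ) :
    IsBandDensity s t (c • φ) :=
  ⟨hφ.memLp.const_smul c, fun ξ hξ => by simp [hφ.eq_zero ξ hξ]⟩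

theorem isBandDensity_zero (s t : ℝ) : IsBandDensity s t (0 : ℝ → ℂ) :=
  ⟨MemLp.zero, fun _ _ => rfl⟩

theorem bandSynthesis_add {s t : ℝ} {φ ψ : ℝ → ℂ} (hφ : IsBandDensity s t φ)
    (hψ : IsBandDensity s t ψ) :
    bandSynthesis (φ + ψ) = bandSynthesis φ + bandSynthesis ψ := by
  ext z
  simp only [bandSynthesis, Pi.add_apply, add_mul]
  exact integral_add (hφ.integrable_mul (by fun_prop)) (hψ.integrable_mul (by fun_prop))

theorem bandSynthesis_smul (c : ℂ) (φ : ℝ → ℂ) :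
    bandSynthesis (c • φ) = c • bandSynthesis φ := by
  ext z
  simp only [bandSynthesis, Pi.smul_apply, smul_eq_mul, mul_assoc]
  exact integral_const_mul _ _

theorem bandSynthesis_zero : bandSynthesis 0 = 0 := by
  ext z
  simp [bandSynthesis]

theorem isBandDensity_sum {ι : Type*} {s t : ℝ} {φ : ι → ℝ → ℂ} (S : Finset ι)
    (hφ : ∀ i ∈ S, IsBandDensity s t (φ i)) : IsBandDensity s t (∑ i ∈ S, φ i) :=
  Finset.sum_induction φ (IsBandDensity s t) (fun _ _ => .add) (isBandDensity_zero s t) hφ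

theorem bandSynthesis_sum {ι : Type*} {s t : ℝ} {φ : ι → ℝ → ℂ} (S : Finset ι)
    (hφ : ∀ i ∈ S, IsBandDensity s t (φ i)) :
    bandSynthesis (∑ i ∈ S, φ i) = ∑ i ∈ S, bandSynthesis (φ i) := by
  classical
  induction S using Finset.induction_on with
  | empty => simpa using bandSynthesis_zero
  | insert i S hi ih =>
    rw [Finset.forall_mem_insert] at hφ
    rw [Finset.sum_insert hi, Finset.sum_insert hi,
      bandSynthesis_add hφ.1 (isBandDensity_sum S hφ.2), ih hφ.2]

namespace BandLimited

variable {s t : ℝ} {f g : ℂ → ℂ}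

theorem mono {s' t' : ℝ} (hf : BandLimited s t f) (hs : s' ≤ s) (ht : t ≤ t') :
    BandLimited s' t' f := by
  obtain ⟨φ, h, rfl⟩ := hf
  exact ⟨φ, ⟨h.memLp, fun ξ hξ => h.eq_zero ξ fun hm => hξ ⟨hs.trans_lt hm.1, hm.2.trans ht⟩⟩,
    rfl⟩

theorem add (hf : BandLimited s t f) (hg : BandLimited s t g) : BandLimited s t (f + g) := by
  obtain ⟨φ, h, rfl⟩ := hf
  obtain ⟨ψ, h', rfl⟩ := hg
  exact ⟨φ + ψ, h.add h', (bandSynthesis_add h h').symm⟩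

theorem const_smul (hf : BandLimited s t f) (c : ℂ) : BandLimited s t (c • f) := by
  obtain ⟨φ, h, rfl⟩ := hf
  exact ⟨c • φ, h.const_smul c, (bandSynthesis_smul c φ).symm⟩

theorem sum {ι : Type*} {f : ι → ℂ → ℂ} (S : Finset ι) (hf : ∀ i ∈ S, BandLimited s t (f i)) :
    BandLimited s t (∑ i ∈ S, f i) :=
  Finset.sum_induction f (BandLimited s t) (fun _ _ => .add)
    ⟨0, isBandDensity_zero s t, bandSynthesis_zero.symm⟩ hf

theorem mul_exp (hf : BandLimited s t f) (b : ℝ) :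
    BandLimited (s + b) (t + b) (fun z => f z * Complex.exp (2 * Real.pi * Complex.I * z * b)) := by
  obtain ⟨φ, h, rfl⟩ := hf
  refine ⟨fun ξ => φ (ξ - b), ⟨h.memLp.comp_measurePreserving
    (measurePreserving_sub_right volume b), fun ξ hξ => h.eq_zero _ fun hm => hξ
      ⟨by linarith [hm.1], by linarith [hm.2]⟩⟩, ?_⟩
  ext z
  simp only [bandSynthesis]
  rw [← integral_sub_right_eq_self _ b, ← integral_mul_const]
  congr with ξ
  rw [mul_assoc, ← Complex.exp_add]
  congr 2
  push_cast
  ring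

/-- The sine is a combination of exponentials of frequency ±1/(2N), each of which translates the
density. -/
theorem mul_sin (hf : BandLimited s t f) {N : ℕ} (a : ℂ) :
    BandLimited (s - 1 / (2 * N)) (t + 1 / (2 * N))
      (fun z => f z * Complex.sin (Real.pi * (z - a) / N)) := by
  have h1 := (hf.mul_exp (1 / (2 * N))).const_smul
    (Complex.exp (-(Real.pi * a / N * Complex.I)) * (-Complex.I / 2))
  have h2 := (hf.mul_exp (-(1 / (2 * N)))).const_smul
    (Complex.exp (Real.pi * a / N * Complex.I) * (Complex.I / 2))
  have hN : (0 : ℝ) ≤ 1 / (2 * N) := by positivity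
  convert (h1.mono (s' := s - 1 / (2 * N)) (by linarith) le_rfl).add
    (h2.mono (t' := t + 1 / (2 * N)) (by linarith) (by linarith)) using 1
  ext z
  have e1 : Complex.exp (2 * Real.pi * Complex.I * z * ((1 / (2 * N) : ℝ) : ℂ))
      = Complex.exp (Real.pi * z / N * Complex.I) := by
    congr 1
    push_cast
    -- For N = 0 division by zero makes both exponents 0.
    rcases eq_or_ne (N : ℂ) 0 with h | h
    · simp [h]
    · field_simp
  have e2 : Complex.exp (2 * Real.pi * Complex.I * z * ((-(1 / (2 * N)) : ℝ) : ℂ))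
      = Complex.exp (-(Real.pi * z / N * Complex.I)) := by
    congr 1
    push_cast
    rcases eq_or_ne (N : ℂ) 0 with h | h
    · simp [h]
    · field_simp
  simp only [Pi.add_apply, Pi.smul_apply, smul_eq_mul, e1, e2, Complex.sin]
  rw [show -((Real.pi : ℂ) * (z - a) / N) * Complex.I
      = -(Real.pi * z / N * Complex.I) + Real.pi * a / N * Complex.I by ring,
    show ((Real.pi : ℂ) * (z - a) / N) * Complex.I
      = Real.pi * z / N * Complex.I + -(Real.pi * a / N * Complex.I) by ring,
    Complex.exp_add, Complex.exp_add]
  ring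

theorem mul_prod_sin {d : ℝ} (hf : BandLimited (-d) d f) {ι : Type*} {N : ℕ} (a c : ι → ℂ)
    (S : Finset ι) :
    BandLimited (-(d + S.card / (2 * N))) (d + S.card / (2 * N))
      (fun z => f z * ∏ i ∈ S, Complex.sin (Real.pi * (z - a i) / N) / c i) := by
  classical
  induction S using Finset.induction_on with
  | empty => simpa using hf
  | insert i S hi ih =>
    convert (ih.mul_sin (N := N) (a i)).const_smul (c i)⁻¹ using 1
    · rw [Finset.card_insert_of_notMem hi]
      push_cast
      ring
    · rw [Finset.card_insert_of_notMem hi]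
      push_cast
      ring
    · ext z
      simp only [Pi.smul_apply, smul_eq_mul, Finset.prod_insert hi]
      ring

end BandLimited

/-! ### The cardinal sine and its products with sines. -/

/-- The frequency density of `z ↦ cardinalSine ((z - a) / N)`. -/
noncomputable def sincDensity (N : ℕ) (a : ℂ) : ℝ → ℂ :=
  (Set.Ioc (-(1 / (2 * N) : ℝ)) (1 / (2 * N))).indicator
    fun ξ => N * Complex.exp (-(2 * Real.pi * Complex.I * a * ξ))

theorem isBandDensity_sincDensity (N : ℕ) (a : ℂ) :
    IsBandDensity (-(1 / (2 * N))) (1 / (2 * N)) (sincDensity N a) := by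
  refine ⟨?_, fun ξ hξ => Set.indicator_of_notMem hξ _⟩
  rw [sincDensity, memLp_indicator_iff_restrict measurableSet_Ioc]
  have hc : Continuous fun ξ : ℝ => (N : ℂ) * Complex.exp (-(2 * Real.pi * Complex.I * a * ξ)) := by
    fun_prop
  obtain ⟨C, hC⟩ := (isCompact_Icc (a := -(1 / (2 * N) : ℝ)) (b := 1 / (2 * N))
    ).exists_bound_of_continuousOn hc.continuousOn
  refine MemLp.of_bound hc.aestronglyMeasurable C ?_
  filter_upwards [ae_restrict_mem measurableSet_Ioc] with ξ hξ
  exact hC ξ (Set.Ioc_subset_Icc_self hξ)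

theorem bandSynthesis_sincDensity {N : ℕ} (hN : 0 < N) (a z : ℂ) :
    bandSynthesis (sincDensity N a) z = cardinalSine ((z - a) / N) := by
  have hN' : (N : ℂ) ≠ 0 := by exact_mod_cast hN.ne'
  have hle : -(1 / (2 * N) : ℝ) ≤ 1 / (2 * N) := by
    have : (0 : ℝ) ≤ 1 / (2 * N) := by positivity
    linarith
  have h1 : bandSynthesis (sincDensity N a) z
      = ∫ ξ in (-(1 / (2 * N) : ℝ))..(1 / (2 * N)),
        N * Complex.exp (2 * Real.pi * Complex.I * (z - a) * ξ) := by
    rw [intervalIntegral.integral_of_le hle, ← integral_indicator measurableSet_Ioc]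
    unfold bandSynthesis sincDensity
    congr with ξ
    by_cases hξ : ξ ∈ Set.Ioc (-(1 / (2 * N) : ℝ)) (1 / (2 * N))
    · rw [Set.indicator_of_mem hξ, Set.indicator_of_mem hξ, mul_assoc, ← Complex.exp_add]
      congr 2
      ring
    · rw [Set.indicator_of_notMem hξ, Set.indicator_of_notMem hξ, zero_mul]
  rw [h1, intervalIntegral.integral_const_mul]
  have hpi : (Real.pi : ℂ) ≠ 0 := by exact_mod_cast Real.pi_ne_zero
  by_cases hz : z - a = 0
  · simp only [hz, mul_zero, zero_mul, Complex.exp_zero, cardinalSine, zero_div, if_true]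
    rw [intervalIntegral.integral_const]
    simp only [Complex.real_smul]
    push_cast
    field_simp
    norm_num
  · rw [integral_exp_mul_complex (by simp [hz, hpi]), cardinalSine,
      if_neg (div_ne_zero hz hN'), Complex.sin]
    have e1 : 2 * Real.pi * Complex.I * (z - a) * ((1 / (2 * N) : ℝ) : ℂ)
        = Real.pi * ((z - a) / N) * Complex.I := by
      push_cast; field_simp
    have e2 : 2 * Real.pi * Complex.I * (z - a) * ((-(1 / (2 * N)) : ℝ) : ℂ)
        = -(Real.pi * ((z - a) / N)) * Complex.I := by
      push_cast; field_simp
    rw [e1, e2]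
    have hI := Complex.I_sq
    field_simp
    rw [hI]
    ring

theorem bandLimited_cardinalSine {N : ℕ} (hN : 0 < N) (a : ℂ) :
    BandLimited (-(1 / (2 * N))) (1 / (2 * N)) (fun z => cardinalSine ((z - a) / N)) :=
  ⟨_, isBandDensity_sincDensity N a, funext fun z => (bandSynthesis_sincDensity hN a z).symm⟩

/-- A cardinal sine times `N - 1` sine factors is in the Paley-Wiener space of type `π`. -/
theorem cardinalSine_mul_prod_sin_mem_paleyWiener {N : ℕ} (hN : 0 < N) (b : ℂ)
    (a c : Fin N → ℂ) (n : Fin N) :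
    (fun z => cardinalSine ((z - b) / N) *
      ∏ s ∈ Finset.univ.erase n, Complex.sin (Real.pi * (z - a s) / N) / c s)
      ∈ PaleyWiener (1 / 2) := by
  have h := (bandLimited_cardinalSine hN b).mul_prod_sin (N := N) a c (Finset.univ.erase n)
  -- The cardinal sine and each of the N - 1 sines contribute 1/(2N) to the half-width.
  have e : (1 / (2 * N) : ℝ) + ((Finset.univ.erase n).card : ℝ) / (2 * N) = 1 / 2 := by
    have hN' : (N : ℝ) ≠ 0 := by exact_mod_cast hN.ne'
    rw [Finset.card_erase_of_mem (Finset.mem_univ n), Finset.card_univ, Fintype.card_fin,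
      Nat.cast_sub hN]
    field_simp
    push_cast
    ring
  rw [e] at h
  exact h.mem_paleyWiener

/-! ### Zeros, and a function vanishing at all samples. -/

theorem cardinalSine_eq_zero_iff {z : ℂ} : cardinalSine z = 0 ↔ ∃ k : ℤ, k ≠ 0 ∧ z = k := by
  have hpi : (Real.pi : ℂ) ≠ 0 := by exact_mod_cast Real.pi_ne_zero
  unfold cardinalSine
  split_ifs with h
  · simp only [one_ne_zero, false_iff, not_exists, not_and]
    rintro k hk rfl
    exact hk (by exact_mod_cast h)
  · rw [div_eq_zero_iff, or_iff_left (mul_ne_zero hpi h), Complex.sin_eq_zero_iff]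
    constructor
    · rintro ⟨k, hk⟩
      have : z = k := mul_left_cancel₀ hpi (hk.trans (mul_comm _ _))
      exact ⟨k, fun hk0 => h (by simpa [hk0] using this), this⟩
    · rintro ⟨k, _, rfl⟩
      exact ⟨k, mul_comm _ _⟩

theorem sin_pi_mul_div_eq_zero_iff {N : ℕ} (hN : 0 < N) {z : ℂ} :
    Complex.sin (Real.pi * z / N) = 0 ↔ ∃ k : ℤ, z = N * k := by
  have hpi : (Real.pi : ℂ) ≠ 0 := by exact_mod_cast Real.pi_ne_zero
  have hN' : (N : ℂ) ≠ 0 := by exact_mod_cast hN.ne'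
  rw [Complex.sin_eq_zero_iff]
  refine exists_congr fun k => ?_
  rw [div_eq_iff hN', mul_comm (k : ℂ), mul_assoc, mul_right_inj' hpi, mul_comm (N : ℂ)]

/-- If two sampling classes coincide, some nonzero function vanishes on all samples. -/
theorem exists_mem_paleyWiener_vanishing {N : ℕ} (hN : 0 < N) (a : Fin N → ℂ) {n m : Fin N}
    (hnm : n ≠ m) {k : ℤ} (hk : a n - a m = (N : ℂ) * (k : ℂ)) :
    ∃ f ∈ PaleyWiener (1 / 2), (∃ x : ℝ, f (x : ℂ) ≠ 0) ∧
      ∀ (n : Fin N) (m : ℤ), f ((N : ℂ) * (m : ℂ) + a n) = 0 := by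
  have hN' : (N : ℂ) ≠ 0 := by exact_mod_cast hN.ne'
  refine ⟨_, cardinalSine_mul_prod_sin_mem_paleyWiener hN (a n) a (fun _ => 1) n, ?_, ?_⟩
  · set Z : Set ℂ := ⋃ s : Fin N, Set.range fun j : ℤ => a s + N * j
    have hZ : Z.Countable := Set.countable_iUnion fun s => Set.countable_range _
    have hZ' : ((fun x : ℝ => (x : ℂ)) ⁻¹' Z).Countable :=
      hZ.preimage Complex.ofReal_injective
    obtain ⟨x, hx⟩ : ∃ x : ℝ, (x : ℂ) ∉ Z := by
      by_contra! h
      exact Cardinal.not_countable_real (hZ'.mono fun x _ => h x)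
    have hx' : ∀ s (j : ℤ), (x : ℂ) - a s ≠ N * j := fun s j he =>
      hx (Set.mem_iUnion.2 ⟨s, j, by simp [← he]⟩)
    refine ⟨x, mul_ne_zero ?_ (Finset.prod_ne_zero_iff.2 fun s _ => ?_)⟩
    · rw [Ne, cardinalSine_eq_zero_iff]
      rintro ⟨j, _, hj⟩
      rw [div_eq_iff hN'] at hj
      exact hx' n j (hj.trans (mul_comm _ _))
    · rw [div_one, Ne, sin_pi_mul_div_eq_zero_iff hN]
      rintro ⟨j, hj⟩
      exact hx' s j hj
  · intro i j
    -- The omitted sine factor for n is replaced by the factor for m, which has the same zeros.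
    have key : ∃ s ∈ Finset.univ.erase n, ∃ l : ℤ, (N : ℂ) * j + a i - a s = N * l := by
      by_cases hi : i = n
      · refine ⟨m, Finset.mem_erase.2 ⟨hnm.symm, Finset.mem_univ _⟩, j + k, ?_⟩
        rw [hi, add_sub_assoc, hk]
        push_cast
        ring
      · exact ⟨i, Finset.mem_erase.2 ⟨hi, Finset.mem_univ _⟩, j, by ring⟩
    obtain ⟨s, hs, hl⟩ := key
    refine mul_eq_zero_of_right _ (Finset.prod_eq_zero hs ?_)
    rw [(sin_pi_mul_div_eq_zero_iff hN).2 hl, zero_div]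

/-! ### Fourier series and the classical sampling theorem. -/

/-- Fourier series of a square integrable function on an interval converge in `L²`, measured on
that interval. -/
theorem tendsto_eLpNorm_sub_fourierSeries {T t : ℝ} [hT : Fact (0 < T)] {Φ : ℝ → ℂ}
    (hΦ : MemLp Φ 2 (volume.restrict (Set.Ioc t (t + T)))) :
    Tendsto (fun S : Finset ℤ => eLpNorm (fun ξ => Φ ξ - ∑ m ∈ S,
        fourierCoeff (AddCircle.liftIoc T t Φ) (-m) * fourier (-m) (ξ : AddCircle T)) 2
      (volume.restrict (Set.Ioc t (t + T)))) atTop (𝓝 0) := by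
  have hF := hΦ.memLp_liftIoc.haarAddCircle
  set F := AddCircle.liftIoc T t Φ with hFdef
  set f := hF.toLp F with hf
  -- Negating the index matches the coefficient at -m with the sample at N m + a.
  have h1 := (Equiv.neg ℤ).hasSum_iff.2 (hasSum_fourier_series_L2 f)
  -- The factor T^{1/2} passes from normalised Haar measure to Lebesgue measure of total mass T.
  have h2 : Tendsto (fun S : Finset ℤ => ENNReal.ofReal (T ^ (1 / 2 : ℝ)) *
      ‖f - ∑ m ∈ S, fourierCoeff f (-m) • fourierLp 2 (-m)‖ₑ) atTop (𝓝 0) := by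
    have h3 : Tendsto (fun S : Finset ℤ => f - ∑ m ∈ S, fourierCoeff f (-m) • fourierLp 2 (-m))
        atTop (𝓝 (f - f)) := tendsto_const_nhds.sub h1
    rw [sub_self] at h3
    have h4 := (continuous_enorm.tendsto _).comp h3
    rw [enorm_zero] at h4
    simpa using ENNReal.Tendsto.const_mul h4 (Or.inr ENNReal.ofReal_ne_top)
  refine h2.congr fun S => ?_
  have hmp := AddCircle.measurePreserving_mk T t
  set G := f - ∑ m ∈ S, fourierCoeff f (-m) • fourierLp 2 (-m) with hG
  have hGae : (G : AddCircle T → ℂ) =ᵐ[AddCircle.haarAddCircle]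
      fun x => F x - ∑ m ∈ S, fourierCoeff F (-m) * fourier (-m) x := by
    have e1 : ∀ᵐ x ∂(AddCircle.haarAddCircle (T := T)), ∀ m ∈ S,
        (fourierLp 2 (-m) : Lp ℂ 2 (AddCircle.haarAddCircle (T := T))) x = fourier (-m) x :=
      (ae_ball_iff S.countable_toSet).2 fun m _ => coeFn_fourierLp 2 (-m)
    have e2 : ∀ᵐ x ∂(AddCircle.haarAddCircle (T := T)), ∀ m ∈ S,
        (fourierCoeff f (-m) • fourierLp 2 (-m) : Lp ℂ 2 (AddCircle.haarAddCircle (T := T))) x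
          = fourierCoeff f (-m) •
            (fourierLp 2 (-m) : Lp ℂ 2 (AddCircle.haarAddCircle (T := T))) x :=
      (ae_ball_iff S.countable_toSet).2 fun m _ => Lp.coeFn_smul _ _
    filter_upwards [Lp.coeFn_sub f (∑ m ∈ S, fourierCoeff f (-m) • fourierLp 2 (-m)),
      Lp.coeFn_finsetSum (s := S) (f := fun m => fourierCoeff f (-m) •
        (fourierLp 2 (-m) : Lp ℂ 2 (AddCircle.haarAddCircle (T := T)))), e1, e2,
      hF.coeFn_toLp] with x x1 x2 x3 x4 x5
    rw [hG, x1, Pi.sub_apply, x2, x5]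
    congr 1
    rw [Finset.sum_apply]
    refine Finset.sum_congr rfl fun m hm => ?_
    rw [x4 m hm, x3 m hm, smul_eq_mul, fourierCoeff_congr_ae hF.coeFn_toLp]
  have hGae' : ∀ᵐ x ∂(volume : Measure (AddCircle T)), (G : AddCircle T → ℂ) x =
      F x - ∑ m ∈ S, fourierCoeff F (-m) * fourier (-m) x := by
    rw [AddCircle.volume_eq_smul_haarAddCircle]
    exact Measure.ae_smul_measure hGae _
  have hae : (fun ξ => Φ ξ - ∑ m ∈ S, fourierCoeff F (-m) * fourier (-m) (ξ : AddCircle T))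
      =ᵐ[volume.restrict (Set.Ioc t (t + T))] (G : AddCircle T → ℂ) ∘ ((↑) : ℝ → AddCircle T) := by
    filter_upwards [hmp.quasiMeasurePreserving.ae hGae', ae_restrict_mem measurableSet_Ioc]
      with ξ h5 hξ
    rw [Function.comp_apply, h5, hFdef, AddCircle.liftIoc_coe_apply hξ]
  have hGm : AEStronglyMeasurable (G : AddCircle T → ℂ) (volume : Measure (AddCircle T)) := by
    rw [AddCircle.volume_eq_smul_haarAddCircle]
    exact (Lp.aestronglyMeasurable G).smul_measure _
  rw [eLpNorm_congr_ae hae, eLpNorm_comp_measurePreserving hGm hmp,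
    AddCircle.volume_eq_smul_haarAddCircle, eLpNorm_smul_measure_of_ne_top (by norm_num),
    Lp.enorm_def, smul_eq_mul, ← ENNReal.ofReal_rpow_of_pos hT.out]
  norm_num

/-- The density of the remainder in the sampling series. -/
noncomputable def samplingRemainder (N : ℕ) (a : ℂ) (φ : ℝ → ℂ) (S : Finset ℤ) : ℝ → ℂ :=
  φ + (-1 : ℂ) • ∑ m ∈ S, bandSynthesis φ (N * m + a) • sincDensity N (N * m + a)

section Sampling

variable {N : ℕ} {φ : ℝ → ℂ}

theorem isBandDensity_samplingRemainder
    (hφ : IsBandDensity (-(1 / (2 * N))) (1 / (2 * N)) φ) (a : ℂ) (S : Finset ℤ) :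
    IsBandDensity (-(1 / (2 * N))) (1 / (2 * N)) (samplingRemainder N a φ S) :=
  hφ.add ((isBandDensity_sum S fun _ _ =>
    (isBandDensity_sincDensity N _).const_smul _).const_smul _)

theorem bandSynthesis_samplingRemainder (hN : 0 < N)
    (hφ : IsBandDensity (-(1 / (2 * N))) (1 / (2 * N)) φ) (a : ℂ) (S : Finset ℤ) (z : ℂ) :
    bandSynthesis (samplingRemainder N a φ S) z = bandSynthesis φ z -
      ∑ m ∈ S, bandSynthesis φ (N * m + a) * cardinalSine ((z - (N * m + a)) / N) := by
  have h1 : ∀ m ∈ S, IsBandDensity (-(1 / (2 * N))) (1 / (2 * N))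
      (bandSynthesis φ (N * m + a) • sincDensity N (N * m + a)) :=
    fun m _ => (isBandDensity_sincDensity N _).const_smul _
  rw [samplingRemainder, bandSynthesis_add hφ ((isBandDensity_sum S h1).const_smul _),
    bandSynthesis_smul, bandSynthesis_sum S h1]
  simp [bandSynthesis_smul, bandSynthesis_sincDensity hN, sub_eq_add_neg]

/-- The Fourier coefficients of φ(ξ) e^{2πiaξ} on a period of length 1/N are N times the samples, so
the sampling error is, on the density side, a Fourier series error times e^{-2πiaξ}. -/
theorem tendsto_eLpNorm_samplingRemainder (hN : 0 < N)
    (hφ : IsBandDensity (-(1 / (2 * N))) (1 / (2 * N)) φ) (a : ℂ) :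
    Tendsto (fun S => eLpNorm (samplingRemainder N a φ S) 2 volume) atTop (𝓝 0) := by
  have hNr : (0 : ℝ) < N := by exact_mod_cast hN
  have hN' : (N : ℂ) ≠ 0 := by exact_mod_cast hN.ne'
  have : Fact ((0 : ℝ) < 1 / N) := ⟨by positivity⟩
  have hint : -(1 / (2 * N) : ℝ) + 1 / N = 1 / (2 * N) := by field_simp; norm_num
  set Φ : ℝ → ℂ := fun ξ => φ ξ * Complex.exp (2 * Real.pi * Complex.I * a * ξ) with hΦdef
  have hΦ : IsBandDensity (-(1 / (2 * N))) (1 / (2 * N)) Φ := hφ.mul_continuous (by fun_prop)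
  have key := tendsto_eLpNorm_sub_fourierSeries (T := 1 / N) (t := -(1 / (2 * N)))
    (hΦ.memLp.restrict _)
  have hcoe : ∀ (n : ℤ) (ξ : ℝ), fourier n (ξ : AddCircle (1 / N : ℝ))
      = Complex.exp (2 * Real.pi * Complex.I * (N * n) * ξ) := by
    intro n ξ
    rw [fourier_coe_apply]
    congr 1
    push_cast
    field_simp
  have hcoeff : ∀ m : ℤ, fourierCoeff (AddCircle.liftIoc (1 / N : ℝ) (-(1 / (2 * N))) Φ) (-m)
      = N * bandSynthesis φ (N * m + a) := by
    intro m
    rw [fourierCoeff_eq_intervalIntegral _ _ (-(1 / (2 * N) : ℝ)), one_div_one_div,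
      Complex.real_smul, Complex.ofReal_natCast, bandSynthesis]
    congr 1
    rw [intervalIntegral.integral_of_le (le_add_of_nonneg_right (by positivity)),
      ← integral_indicator measurableSet_Ioc]
    congr with ξ
    by_cases hξ : ξ ∈ Set.Ioc (-(1 / (2 * N) : ℝ)) (-(1 / (2 * N)) + 1 / N)
    · rw [Set.indicator_of_mem hξ, AddCircle.liftIoc_coe_apply hξ, hcoe, hΦdef, neg_neg,
        smul_eq_mul, mul_left_comm, ← Complex.exp_add]
      congr 2
      ring
    · rw [Set.indicator_of_notMem hξ]
      rw [hint] at hξ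
      rw [hφ.eq_zero ξ hξ, zero_mul]
  have hc : Continuous fun ξ : ℝ => Complex.exp (-(2 * Real.pi * Complex.I * a * ξ)) := by
    fun_prop
  -- For complex a this exponential is not unimodular, but it is bounded on the band.
  obtain ⟨C, hC⟩ := (isCompact_Icc (a := -(1 / (2 * N) : ℝ)) (b := 1 / (2 * N))
    ).exists_bound_of_continuousOn hc.continuousOn
  have key2 := ENNReal.Tendsto.const_mul (a := ENNReal.ofReal C) key
    (Or.inr ENNReal.ofReal_ne_top)
  rw [mul_zero] at key2
  refine tendsto_of_tendsto_of_tendsto_of_le_of_le tendsto_const_nhds key2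
    (fun _ => zero_le) fun S => ?_
  dsimp only
  rw [← eLpNorm_restrict_eq_of_support_subset
    (isBandDensity_samplingRemainder hφ a S).support_subset, hint]
  refine eLpNorm_le_mul_eLpNorm_of_ae_le_mul ?_ 2
  filter_upwards [ae_restrict_mem measurableSet_Ioc] with ξ hξ
  have e : samplingRemainder N a φ S ξ = Complex.exp (-(2 * Real.pi * Complex.I * a * ξ)) *
      (Φ ξ - ∑ m ∈ S, fourierCoeff (AddCircle.liftIoc (1 / N : ℝ) (-(1 / (2 * N))) Φ) (-m) *
        fourier (-m) (ξ : AddCircle (1 / N : ℝ))) := by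
    have e0 : Complex.exp (-(2 * Real.pi * Complex.I * a * ξ)) *
        Complex.exp (2 * Real.pi * Complex.I * a * ξ) = 1 := by
      rw [← Complex.exp_add, neg_add_cancel, Complex.exp_zero]
    rw [mul_sub, Finset.mul_sum, hΦdef, mul_left_comm, e0, mul_one, samplingRemainder,
      Pi.add_apply, Pi.smul_apply, Finset.sum_apply, neg_one_smul, ← sub_eq_add_neg]
    congr 1
    refine Finset.sum_congr rfl fun m _ => ?_
    rw [hcoeff, hcoe, Pi.smul_apply, sincDensity, Set.indicator_of_mem hξ, smul_eq_mul,
      show -(2 * Real.pi * Complex.I * (N * m + a) * ξ) =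
        -(2 * Real.pi * Complex.I * a * ξ) + 2 * Real.pi * Complex.I * (N * ((-m : ℤ) : ℂ)) * ξ by
        push_cast; ring, Complex.exp_add]
    ring
  rw [e, norm_mul]
  exact mul_le_mul_of_nonneg_right (hC ξ (Set.Ioc_subset_Icc_self hξ)) (norm_nonneg _)

end Sampling

/-! ### Splitting the band into N pieces. -/

/-- The part of the density `φ` in the band of width `1 / N` centred at `b`, moved to the
origin. -/
noncomputable def bandPiece (N : ℕ) (φ : ℝ → ℂ) (b : ℝ) : ℝ → ℂ :=
  (Set.Ioc (-(1 / (2 * N) : ℝ)) (1 / (2 * N))).indicator fun ξ => φ (ξ + b)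

theorem isBandDensity_bandPiece (N : ℕ) {φ : ℝ → ℂ} (hφ : MemLp φ 2 volume) (b : ℝ) :
    IsBandDensity (-(1 / (2 * N))) (1 / (2 * N)) (bandPiece N φ b) :=
  ⟨(hφ.comp_measurePreserving (measurePreserving_add_right volume b)).indicator
    measurableSet_Ioc, fun _ hξ => Set.indicator_of_notMem hξ _⟩

theorem exp_mul_bandSynthesis_bandPiece (N : ℕ) (φ : ℝ → ℂ) (b : ℝ) (z : ℂ) :
    Complex.exp (2 * Real.pi * Complex.I * z * b) * bandSynthesis (bandPiece N φ b) z =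
      ∫ ξ in (-(1 / (2 * N) : ℝ) + b)..(1 / (2 * N) + b),
        φ ξ * Complex.exp (2 * Real.pi * Complex.I * z * ξ) := by
  have hN : (0 : ℝ) ≤ 1 / (2 * N) := by positivity
  rw [← intervalIntegral.integral_comp_add_right (fun ξ : ℝ =>
      φ ξ * Complex.exp (2 * Real.pi * Complex.I * z * ξ)),
    intervalIntegral.integral_of_le (by linarith), ← integral_indicator measurableSet_Ioc,
    bandSynthesis, ← integral_const_mul]
  congr with ξ
  by_cases hξ : ξ ∈ Set.Ioc (-(1 / (2 * N) : ℝ)) (1 / (2 * N))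
  · rw [bandPiece, Set.indicator_of_mem hξ, Set.indicator_of_mem hξ, mul_left_comm,
      ← Complex.exp_add]
    congr 2
    push_cast
    ring
  · rw [bandPiece, Set.indicator_of_notMem hξ, Set.indicator_of_notMem hξ, zero_mul, mul_zero]

/-- A function with spectrum in `(-1/2, 1/2]` is a sum of `N` modulated functions with spectrum in
`(-1/(2N), 1/(2N)]`. -/
theorem bandSynthesis_eq_sum_bandPiece {N : ℕ} (hN : 0 < N) {φ : ℝ → ℂ}
    (hφ : IsBandDensity (-(1 / 2)) (1 / 2) φ) (z : ℂ) :
    bandSynthesis φ z = ∑ k ∈ Finset.range N,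
      Complex.exp (2 * Real.pi * Complex.I * z * ((-(1 / 2) + (2 * k + 1) / (2 * N) : ℝ) : ℂ)) *
        bandSynthesis (bandPiece N φ (-(1 / 2) + (2 * k + 1) / (2 * N))) z := by
  have hNr : (N : ℝ) ≠ 0 := by exact_mod_cast hN.ne'
  have hi := hφ.integrable_mul (e := fun ξ : ℝ => Complex.exp (2 * Real.pi * Complex.I * z * ξ))
    (by fun_prop)
  -- The cuts are -1/2 + k/N; the band centres -1/2 + (2k+1)/(2N) are the midpoints.
  have h1 := intervalIntegral.sum_integral_adjacent_intervals (μ := volume) (n := N)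
    (a := fun k : ℕ => -(1 / 2) + (k : ℝ) / N) fun k _ => hi.intervalIntegrable
  have h2 : (∫ ξ in (-(1 / 2) + ((0 : ℕ) : ℝ) / N)..(-(1 / 2) + (N : ℝ) / N),
      φ ξ * Complex.exp (2 * Real.pi * Complex.I * z * ξ)) = bandSynthesis φ z := by
    rw [div_self hNr, Nat.cast_zero, zero_div, add_zero,
      show (-(1 / 2) + 1 : ℝ) = 1 / 2 by norm_num, intervalIntegral.integral_of_le (by norm_num),
      setIntegral_eq_integral_of_forall_compl_eq_zero fun ξ hξ => by rw [hφ.eq_zero ξ hξ, zero_mul],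
      bandSynthesis]
  rw [← h2, ← h1]
  refine Finset.sum_congr rfl fun k _ => ?_
  rw [exp_mul_bandSynthesis_bandPiece]
  congr 1
  · field_simp
    ring
  · push_cast
    field_simp
    ring

/-! ### Lagrange interpolation in e^{2πiz/N}. -/

/-- The character of period `N`. -/
noncomputable def periodicExp (N : ℕ) (z : ℂ) : ℂ :=
  Complex.exp (2 * Real.pi * Complex.I * z / N)

theorem norm_periodicExp_ofReal (N : ℕ) (x : ℝ) : ‖periodicExp N x‖ = 1 := by
  rw [periodicExp, show 2 * Real.pi * Complex.I * (x : ℂ) / N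
    = ((2 * Real.pi * x / N : ℝ) : ℂ) * Complex.I by push_cast; ring]
  exact Complex.norm_exp_ofReal_mul_I _

theorem periodicExp_int_mul_add {N : ℕ} (hN : 0 < N) (m : ℤ) (z : ℂ) :
    periodicExp N (N * m + z) = periodicExp N z := by
  have hN' : (N : ℂ) ≠ 0 := by exact_mod_cast hN.ne'
  rw [periodicExp, periodicExp, show 2 * Real.pi * Complex.I * (N * m + z) / N
    = 2 * Real.pi * Complex.I * z / N + m * (2 * Real.pi * Complex.I) by field_simp; ring]
  exact Complex.exp_periodic.int_mul m _

theorem periodicExp_eq_iff {N : ℕ} (hN : 0 < N) {z w : ℂ} :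
    periodicExp N z = periodicExp N w ↔ ∃ k : ℤ, z - w = N * k := by
  have hN' : (N : ℂ) ≠ 0 := by exact_mod_cast hN.ne'
  have h2 : (2 * Real.pi * Complex.I : ℂ) ≠ 0 := Complex.two_pi_I_ne_zero
  rw [periodicExp, periodicExp, Complex.exp_eq_exp_iff_exists_int]
  refine exists_congr fun k => ?_
  rw [← sub_eq_iff_eq_add', ← sub_div, ← mul_sub, div_eq_iff hN',
    show (k : ℂ) * (2 * Real.pi * Complex.I) * N = 2 * Real.pi * Complex.I * (N * k) by ring,
    mul_right_inj' h2]

theorem sin_eq_periodicExp_sub (N : ℕ) (z w : ℂ) :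
    Complex.sin (Real.pi * (z - w) / N) =
      Complex.exp (-(Real.pi * Complex.I * (z + w) / N)) *
        (periodicExp N z - periodicExp N w) * (-Complex.I / 2) := by
  rw [Complex.sin, periodicExp, periodicExp, mul_sub (Complex.exp _), ← Complex.exp_add,
    ← Complex.exp_add,
    show -(Real.pi * Complex.I * (z + w) / N) + 2 * Real.pi * Complex.I * z / N
      = Real.pi * (z - w) / N * Complex.I by ring,
    show -(Real.pi * Complex.I * (z + w) / N) + 2 * Real.pi * Complex.I * w / N
      = -(Real.pi * (z - w) / N) * Complex.I by ring]
  ring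

/-- The surviving exponential does not depend on w, so a product of N - 1 such quotients only raises
it to the power N - 1. -/
theorem sin_div_sin_eq_periodicExp (N : ℕ) (z u w : ℂ) :
    Complex.sin (Real.pi * (z - w) / N) / Complex.sin (Real.pi * (u - w) / N) =
      Complex.exp (-(Real.pi * Complex.I * (z - u) / N)) *
        ((periodicExp N u - periodicExp N w)⁻¹ * (periodicExp N z - periodicExp N w)) := by
  rw [sin_eq_periodicExp_sub, sin_eq_periodicExp_sub,
    show -(Real.pi * Complex.I * (z + w) / N) = -(Real.pi * Complex.I * (z - u) / N)
      + -(Real.pi * Complex.I * (u + w) / N) by ring, Complex.exp_add,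
    mul_div_mul_right _ _ (by simp), mul_assoc, mul_div_assoc,
    mul_div_mul_left _ _ (Complex.exp_ne_zero _),
    div_eq_inv_mul (periodicExp N z - _)]

theorem prod_sin_div_sin {N : ℕ} (hN : 0 < N) (a : Fin N → ℂ) (n : Fin N) (z : ℂ) :
    ∏ s ∈ Finset.univ.erase n, Complex.sin ((Real.pi : ℂ) * (z - a s) / (N : ℂ)) /
        Complex.sin ((Real.pi : ℂ) * (a n - a s) / (N : ℂ)) =
      Complex.exp (-(Real.pi * Complex.I * (N - 1) * (z - a n) / N)) *
        (Lagrange.basis Finset.univ (fun s => periodicExp N (a s)) n).eval (periodicExp N z) := by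
  simp only [sin_div_sin_eq_periodicExp]
  rw [Finset.prod_mul_distrib, Finset.prod_const, Finset.card_erase_of_mem (Finset.mem_univ n),
    Finset.card_univ, Fintype.card_fin, ← Complex.exp_nat_mul, Lagrange.basis,
    Polynomial.eval_prod]
  congr 1
  · rw [Nat.cast_sub hN]
    congr 1
    push_cast
    ring
  · simp [Lagrange.basisDivisor]

/-- N nodes reproduce polynomials of degree below N, and the N band pieces carry exactly the powers
k < N. -/
theorem sum_pow_mul_eval_lagrangeBasis {N : ℕ} {w : Fin N → ℂ} (hw : Function.Injective w)
    {k : ℕ} (hk : k < N) (y : ℂ) :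
    ∑ n, w n ^ k * (Lagrange.basis Finset.univ w n).eval y = y ^ k := by
  have h := Lagrange.eq_interpolate (s := Finset.univ) (v := w) (f := Polynomial.X ^ k)
    hw.injOn (by simpa using hk)
  have h2 := congrArg (Polynomial.eval y) h
  rw [Lagrange.interpolate_apply, Polynomial.eval_finsetSum] at h2
  simpa using h2.symm

/-- The combination of the band pieces of `φ` whose samples along `N ℤ + u` are those of the
function with density `φ`, up to modulation. -/
noncomputable def sampledDensity (N : ℕ) (φ : ℝ → ℂ) (u : ℂ) : ℝ → ℂ :=
  ∑ k ∈ Finset.range N,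
    periodicExp N u ^ k • bandPiece N φ (-(1 / 2) + (2 * k + 1) / (2 * N))

section Reconstruction

variable {N : ℕ} {φ : ℝ → ℂ}

theorem isBandDensity_sampledDensity (hφ : MemLp φ 2 volume) (u : ℂ) :
    IsBandDensity (-(1 / (2 * N))) (1 / (2 * N)) (sampledDensity N φ u) :=
  isBandDensity_sum _ fun _ _ => (isBandDensity_bandPiece N hφ _).const_smul _

theorem bandSynthesis_sampledDensity (hφ : MemLp φ 2 volume) (u z : ℂ) :
    bandSynthesis (sampledDensity N φ u) z = ∑ k ∈ Finset.range N, periodicExp N u ^ k *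
      bandSynthesis (bandPiece N φ (-(1 / 2) + (2 * k + 1) / (2 * N))) z := by
  rw [sampledDensity, bandSynthesis_sum _ fun k _ =>
    (isBandDensity_bandPiece N hφ _).const_smul _]
  simp [bandSynthesis_smul]

/-- The k-th band centre equals -(N-1)/(2N) + k/N. -/
theorem bandSynthesis_eq_exp_mul_sum (hN : 0 < N) (hφ : IsBandDensity (-(1 / 2)) (1 / 2) φ)
    (z : ℂ) :
    bandSynthesis φ z = Complex.exp (-(Real.pi * Complex.I * (N - 1) * z / N)) *
      ∑ k ∈ Finset.range N, periodicExp N z ^ k *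
        bandSynthesis (bandPiece N φ (-(1 / 2) + (2 * k + 1) / (2 * N))) z := by
  have hN' : (N : ℂ) ≠ 0 := by exact_mod_cast hN.ne'
  rw [bandSynthesis_eq_sum_bandPiece hN hφ, Finset.mul_sum]
  refine Finset.sum_congr rfl fun k _ => ?_
  rw [← mul_assoc, periodicExp, ← Complex.exp_nat_mul, ← Complex.exp_add]
  congr 2
  push_cast
  field_simp
  ring

theorem bandSynthesis_sample (hN : 0 < N) (hφ : IsBandDensity (-(1 / 2)) (1 / 2) φ)
    (m : ℤ) (u : ℂ) :
    bandSynthesis φ (N * m + u) =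
      Complex.exp (-(Real.pi * Complex.I * (N - 1) * (N * m + u) / N)) *
        bandSynthesis (sampledDensity N φ u) (N * m + u) := by
  rw [bandSynthesis_eq_exp_mul_sum hN hφ, bandSynthesis_sampledDensity hφ.memLp,
    periodicExp_int_mul_add hN]

theorem bandSynthesis_eq_sum_lagrangeBasis (hN : 0 < N)
    (hφ : IsBandDensity (-(1 / 2)) (1 / 2) φ) {a : Fin N → ℂ}
    (ha : Function.Injective fun n => periodicExp N (a n)) (z : ℂ) :
    bandSynthesis φ z = ∑ n, Complex.exp (-(Real.pi * Complex.I * (N - 1) * z / N)) *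
      (Lagrange.basis Finset.univ (fun s => periodicExp N (a s)) n).eval (periodicExp N z) *
        bandSynthesis (sampledDensity N φ (a n)) z := by
  rw [bandSynthesis_eq_exp_mul_sum hN hφ]
  simp only [bandSynthesis_sampledDensity hφ.memLp, mul_assoc]
  rw [← Finset.mul_sum]
  congr 1
  simp only [Finset.mul_sum]
  rw [Finset.sum_comm]
  refine Finset.sum_congr rfl fun k hk => ?_
  rw [← sum_pow_mul_eval_lagrangeBasis ha (Finset.mem_range.1 hk), Finset.sum_mul]
  exact Finset.sum_congr rfl fun n _ => by ring

end Reconstruction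

/-! ### The sampling formula and its convergence. -/

/-- The interpolating functions of the sampling formula. -/
noncomputable def samplingKernel (N : ℕ) (a : Fin N → ℂ) (n : Fin N) (x : ℂ) : ℂ :=
  cardinalSine ((x - a n) / (N : ℂ)) *
    ∏ s ∈ Finset.univ.erase n,
      Complex.sin ((Real.pi : ℂ) * (x - a s) / (N : ℂ)) /
        Complex.sin ((Real.pi : ℂ) * (a n - a s) / (N : ℂ))

/-- On the class of a_n, the modulation in the sample and the one in the kernel multiply to a factor
independent of m, which leaves a classical sampling sum. -/
theorem sub_samplingPartialSum_eq {N : ℕ} (hN : 0 < N) {φ : ℝ → ℂ}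
    (hφ : IsBandDensity (-(1 / 2)) (1 / 2) φ) {a : Fin N → ℂ}
    (ha : Function.Injective fun n => periodicExp N (a n)) (S : Finset (Fin N × ℤ)) (x : ℝ) :
    bandSynthesis φ x - samplingPartialSum N a (samplingKernel N a) (bandSynthesis φ) S x =
      ∑ n, Complex.exp (-(Real.pi * Complex.I * (N - 1) * x / N)) *
        (Lagrange.basis Finset.univ (fun s => periodicExp N (a s)) n).eval (periodicExp N x) *
          bandSynthesis (samplingRemainder N (a n) (sampledDensity N φ (a n))
            (S.preimage (Prod.mk n) (Prod.mk_right_injective n).injOn)) x := by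
  simp only [bandSynthesis_samplingRemainder hN (isBandDensity_sampledDensity hφ.memLp _),
    mul_sub (Complex.exp _ * _), Finset.sum_sub_distrib]
  rw [← bandSynthesis_eq_sum_lagrangeBasis hN hφ ha]
  congr 1
  rw [samplingPartialSum, Finset.sum_finset_product S Finset.univ
    (fun n => S.preimage (Prod.mk n) (Prod.mk_right_injective n).injOn) (by simp)]
  refine Finset.sum_congr rfl fun n _ => ?_
  rw [Finset.mul_sum]
  refine Finset.sum_congr rfl fun m _ => ?_
  have hper : periodicExp N ((x : ℂ) - N * m) = periodicExp N x := by
    rw [← periodicExp_int_mul_add hN m, add_sub_cancel]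
  rw [bandSynthesis_sample hN hφ, samplingKernel, prod_sin_div_sin hN, hper,
    sub_sub,
    show -(Real.pi * Complex.I * (N - 1) * (x : ℂ) / N) =
      -(Real.pi * Complex.I * (N - 1) * (N * m + a n) / N) +
      -(Real.pi * Complex.I * (N - 1) * (x - (N * m + a n)) / N) by ring, Complex.exp_add]
  ring

/-- For real x the exponential is unimodular and the polynomial is evaluated on the unit circle,
which is compact. -/
theorem exists_bound_lagrangeBasis (N : ℕ) (a : Fin N → ℂ) (n : Fin N) :
    ∃ C : ℝ, ∀ x : ℝ, ‖Complex.exp (-(Real.pi * Complex.I * (N - 1) * x / N)) *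
      (Lagrange.basis Finset.univ (fun s => periodicExp N (a s)) n).eval
        (periodicExp N x)‖ ≤ C := by
  obtain ⟨C, hC⟩ := (isCompact_sphere (0 : ℂ) 1).exists_bound_of_continuousOn
    (Lagrange.basis Finset.univ (fun s => periodicExp N (a s)) n).continuous.continuousOn
  refine ⟨C, fun x => ?_⟩
  rw [norm_mul, show -(Real.pi * Complex.I * (N - 1) * (x : ℂ) / N)
    = ((-(Real.pi * (N - 1) * x / N) : ℝ) : ℂ) * Complex.I by push_cast; ring,
    Complex.norm_exp_ofReal_mul_I, one_mul]
  exact hC _ (by simp [norm_periodicExp_ofReal])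

theorem isInterpolationFormula_samplingKernel {N : ℕ} (hN : 0 < N) {a : Fin N → ℂ}
    (ha : ∀ n m : Fin N, n ≠ m → ¬ ∃ k : ℤ, a n - a m = (N : ℂ) * (k : ℂ)) :
    IsInterpolationFormula N a (samplingKernel N a) := by
  refine ⟨fun n => cardinalSine_mul_prod_sin_mem_paleyWiener hN _ _ _ n, fun f hf => ?_⟩
  obtain ⟨φ, hφ, rfl⟩ := mem_paleyWiener_iff_bandLimited.1 hf
  have hinj : Function.Injective fun n => periodicExp N (a n) := fun n m hnm => by
    by_contra hne
    exact ha n m hne ((periodicExp_eq_iff hN).1 hnm)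
  choose C hC using exists_bound_lagrangeBasis N a
  set ρ : Fin N → Finset (Fin N × ℤ) → ℝ → ℂ := fun n S => samplingRemainder N (a n)
    (sampledDensity N φ (a n)) (S.preimage (Prod.mk n) (Prod.mk_right_injective n).injOn)
  have hρ : ∀ n S, IsBandDensity (-(1 / (2 * N))) (1 / (2 * N)) (ρ n S) := fun n S =>
    isBandDensity_samplingRemainder (isBandDensity_sampledDensity hφ.memLp _) _ _
  -- One majorant serves both modes of convergence. The fibres of S over each n exhaust ℤ as S
  -- grows, so unconditional convergence follows class by class.
  have hlim : Tendsto (fun S => ∑ n, ENNReal.ofReal (C n) * eLpNorm (ρ n S) 2 volume)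
      atTop (𝓝 0) := by
    have h1 : ∀ n, Tendsto (fun S => ENNReal.ofReal (C n) * eLpNorm (ρ n S) 2 volume)
        atTop (𝓝 0) := fun n => by
      have h2 := (tendsto_eLpNorm_samplingRemainder hN
        (isBandDensity_sampledDensity hφ.memLp (a n)) (a n)).comp
        (tendsto_finset_preimage_atTop_atTop (Prod.mk_right_injective n))
      simpa using ENNReal.Tendsto.const_mul h2 (Or.inr ENNReal.ofReal_ne_top)
    simpa using tendsto_finsetSum Finset.univ fun n _ => h1 n
  have hterm : ∀ n S (x : ℝ), ‖Complex.exp (-(Real.pi * Complex.I * (N - 1) * x / N)) *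
      (Lagrange.basis Finset.univ (fun s => periodicExp N (a s)) n).eval (periodicExp N x) *
        bandSynthesis (ρ n S) x‖ ≤ C n * ‖bandSynthesis (ρ n S) x‖ := fun n S x => by
    rw [norm_mul]
    exact mul_le_mul_of_nonneg_right (hC n x) (norm_nonneg _)
  have hcont : ∀ n S, Continuous fun x : ℝ =>
      Complex.exp (-(Real.pi * Complex.I * (N - 1) * x / N)) *
        (Lagrange.basis Finset.univ (fun s => periodicExp N (a s)) n).eval (periodicExp N x) *
          bandSynthesis (ρ n S) x := fun n S => by
    refine (Continuous.mul (by fun_prop) ?_).mul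
      ((hρ n S).differentiable.continuous.comp Complex.continuous_ofReal)
    refine (Polynomial.continuous _).comp ?_
    unfold periodicExp
    fun_prop
  constructor
  · refine tendsto_of_tendsto_of_tendsto_of_le_of_le tendsto_const_nhds hlim
      (fun _ => zero_le) fun S => ?_
    simp only [sub_samplingPartialSum_eq hN hφ hinj]
    rw [← Finset.sum_fn]
    refine (eLpNorm_sum_le (fun n _ => (hcont n S).aestronglyMeasurable) (by norm_num)).trans
      (Finset.sum_le_sum fun n _ => ?_)
    rw [← (hρ n S).eLpNorm_bandSynthesis]
    exact eLpNorm_le_mul_eLpNorm_of_ae_le_mul (.of_forall fun x => hterm n S x) 2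
  · set K : ENNReal := ENNReal.ofReal (1 / (2 * N) - -(1 / (2 * N))) ^ (1 / 2 : ℝ)
    have hlim2 := ENNReal.Tendsto.mul_const (b := K) hlim (Or.inr (by finiteness))
    rw [zero_mul] at hlim2
    rw [EMetric.tendstoUniformly_iff]
    intro ε hε
    filter_upwards [hlim2.eventually_lt_const hε] with S hS x
    refine lt_of_le_of_lt ?_ hS
    rw [edist_eq_enorm_sub, sub_samplingPartialSum_eq hN hφ hinj, Finset.sum_mul]
    refine (enorm_sum_le _ _).trans (Finset.sum_le_sum fun n _ => ?_)
    rw [mul_assoc (ENNReal.ofReal (C n))]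
    refine le_trans ?_ (mul_le_mul_right ((hρ n S).enorm_bandSynthesis_le x)
      (ENNReal.ofReal (C n)))
    rw [← ofReal_norm, ← ofReal_norm (bandSynthesis (ρ n S) x),
      ← ENNReal.ofReal_mul ((norm_nonneg _).trans (hC n x))]
    exact ENNReal.ofReal_le_ofReal (hterm n S x)

/-! ### Necessity and conclusion. -/

theorem not_isInterpolationFormula {N : ℕ} (hN : 0 < N) {a : Fin N → ℂ} {n m : Fin N}
    (hnm : n ≠ m) {k : ℤ} (hk : a n - a m = (N : ℂ) * (k : ℂ)) (g : Fin N → ℂ → ℂ) :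
    ¬ IsInterpolationFormula N a g := by
  rintro ⟨_, hg⟩
  obtain ⟨f, hf, ⟨x, hx⟩, hz⟩ := exists_mem_paleyWiener_vanishing hN a hnm hk
  have h1 := (hg f hf).2.tendsto_at x
  have h2 : (fun S => samplingPartialSum N a g f S x) = fun _ => 0 := by
    ext S
    simp [samplingPartialSum, hz]
  rw [h2] at h1
  exact hx (tendsto_nhds_unique h1 tendsto_const_nhds)

theorem mainTheorem4 (N : ℕ) (hN : 1 ≤ N) (a : Fin N → ℂ) :
    -- the explicit formula
    ((∀ n m : Fin N, n ≠ m → ¬ ∃ k : ℤ, a n - a m = (N : ℂ) * (k : ℂ)) →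
      IsInterpolationFormula N a (fun n x =>
        cardinalSine ((x - a n) / (N : ℂ)) *
          ∏ s ∈ Finset.univ.erase n,
            Complex.sin ((Real.pi : ℂ) * (x - a s) / (N : ℂ)) /
              Complex.sin ((Real.pi : ℂ) * (a n - a s) / (N : ℂ)))) ∧
    -- a formula exists exactly under the condition
    ((∃ g : Fin N → ℂ → ℂ, IsInterpolationFormula N a g) ↔
      ∀ n m : Fin N, n ≠ m → ¬ ∃ k : ℤ, a n - a m = (N : ℂ) * (k : ℂ)) ∧
    -- if the condition fails, the samples do not even determine the function
    ((∃ n m : Fin N, n ≠ m ∧ ∃ k : ℤ, a n - a m = (N : ℂ) * (k : ℂ)) →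
      ∃ f ∈ PaleyWiener (1 / 2), (∃ x : ℝ, f (x : ℂ) ≠ 0) ∧
        ∀ (n : Fin N) (m : ℤ), f ((N : ℂ) * (m : ℂ) + a n) = 0) := by
  refine ⟨isInterpolationFormula_samplingKernel hN, ⟨?_, fun h =>
    ⟨_, isInterpolationFormula_samplingKernel hN h⟩⟩, ?_⟩
  · rintro ⟨g, hg⟩ n m hnm ⟨k, hk⟩
    exact not_isInterpolationFormula hN hnm hk g hg
  · rintro ⟨n, m, hnm, k, hk⟩
    exact exists_mem_paleyWiener_vanishing hN a hnm hk
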